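/- Let $A\in\mathbb C^{n\times n}$, $B\in\mathbb C^{n\times m}$, and let $G\in\mathbb C^{n\times n}$, $\Gamma\in\mathbb C^{m\times m}$ be Hermitian with $\det\Gamma\neq 0$. Consider the Riccati inequality $$HA+A^{*}H+G-HB\Gamma^{-1}B^{*}H<0 \qquad (1)$$ for a Hermitian matrix $H\in\mathbb C^{n\times n}$, where $<0$ means negative definite; no sign condition is imposed on $\Gamma$. Assume that the pair $(A,\,B\Gamma^{-1}B^{*})$ is controllable, i.e. with $D=B\Gamma^{-1}B^{*}$ the matrix $[D,\,AD,\,\dots,\,A^{n-1}D]$ has rank $n$. (If $B$ has full column rank or $\Gamma$ is definite, this is the same as controllability of $(A,B)$.) If the Hamiltonian matrix $$R=\begin{pmatrix}A&-B\Gamma^{-1}B^{*}\\-G&-A^{*}\end{pmatrix}$$ has no eigenvalues on the imaginary axis, then (1) has a stabilizing solution $H_-$ and an anti-stabilizing solution $H_+$: both are Hermitian and satisfy (1), and all eigenvalues of $A-B\Gamma^{-1}B^{*}H_-$ and of $-(A-B\Gamma^{-1}B^{*}H_+)$ have negative real part (that is, these two matrices are Hurwitz). -/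

import Mathlib

open scoped Matrix ComplexOrder

namespace RiccatiInequality

/-- A square complex matrix is Hurwitz if all its eigenvalues have negative real part. -/
def IsHurwitz {n : ℕ} (M : Matrix (Fin n) (Fin n) ℂ) : Prop :=
  ∀ z ∈ spectrum ℂ M, z.re < 0

/-- The block matrix `[B, A B, A² B, …, Aⁿ⁻¹ B]`, whose columns are indexed by
(block, column of `B`). -/
def controllabilityMatrix {n m : ℕ} (A : Matrix (Fin n) (Fin n) ℂ)
    (B : Matrix (Fin n) (Fin m) ℂ) : Matrix (Fin n) (Fin n × Fin m) ℂ :=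
  Matrix.of fun i p => (A ^ (p.1 : ℕ) * B) i p.2

/-- The pair `(A, B)` is controllable: the controllability matrix has full row rank. -/
def IsControllable {n m : ℕ} (A : Matrix (Fin n) (Fin n) ℂ)
    (B : Matrix (Fin n) (Fin m) ℂ) : Prop :=
  (controllabilityMatrix A B).rank = n

/-- The Hamiltonian matrix `R = [A, -B Γ⁻¹ B*; -G, -A*]`. -/
noncomputable def hamiltonian {n m : ℕ} (A : Matrix (Fin n) (Fin n) ℂ)
    (B : Matrix (Fin n) (Fin m) ℂ) (G : Matrix (Fin n) (Fin n) ℂ)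
    (Γ : Matrix (Fin m) (Fin m) ℂ) : Matrix (Fin n ⊕ Fin n) (Fin n ⊕ Fin n) ℂ :=
  Matrix.fromBlocks A (-(B * Γ⁻¹ * Bᴴ)) (-G) (-Aᴴ)

/-- `H` is a Hermitian solution of the strict Riccati inequality
`H A + A* H + G - H B Γ⁻¹ B* H < 0` (negative definiteness). -/
def IsSolution {n m : ℕ} (A : Matrix (Fin n) (Fin n) ℂ)
    (B : Matrix (Fin n) (Fin m) ℂ) (G : Matrix (Fin n) (Fin n) ℂ)
    (Γ : Matrix (Fin m) (Fin m) ℂ) (H : Matrix (Fin n) (Fin n) ℂ) : Prop :=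
  H.IsHermitian ∧ (-(H * A + Aᴴ * H + G - H * B * Γ⁻¹ * Bᴴ * H)).PosDef

end RiccatiInequality

/-!
Write `D = B Γ⁻¹ B*` and let `J` be the standard symplectic form. The Riccati expression of `H` is
the quantity `[1; H]* J R [1; H]`, so it transforms well under symplectic changes of basis. Since
`R` is Hamiltonian without imaginary eigenvalues, there is a symplectic `T = [U, U'; V, V']` with
`R T = T diag(S, -S*)` and `S` Hurwitz. In the new basis the Riccati inequality for a graph `[1; Y]`
is the Lyapunov inequality `S* Y + Y S < 0`, solved by `Y = t (Z₀ + t Z₁)` with `t > 0`,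
`S* Z₀ + Z₀ S = -U* U` and `S* Z₁ + Z₁ S = -1`.

Mapping back by `T`, the graph of `Y` is the graph of a Hermitian `H` as soon as
`X = U + U' Y` is invertible, and `A - D H` is then similar to
`S + t X⁻¹ U' (U* U + t)`. Here `U` may be singular, so `X⁻¹` may blow up as `t → 0`.
Controllability makes `Z₀` positive definite, hence `U' Z₀` maps `ker U` onto a complement of the
range of `U`. So `t X⁻¹` converges to some `L` with `L U = 0`, and because `U' U* = U U'*` the
matrix above converges to `S`: it is Hurwitz for small `t`. Replacing `(A, H)` by `(-A, -H)` gives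
the anti-stabilizing solution.
-/

open Filter Topology

namespace RiccatiInequality

section Lyapunov

theorem tendsto_pow_atTop_nhds_zero_of_spectrum {E : Type*} [NormedRing E] [NormedAlgebra ℂ E]
    [CompleteSpace E] {a : E} (ha : ∀ z ∈ spectrum ℂ a, ‖z‖ < 1) :
    Tendsto (fun k => a ^ k) atTop (𝓝 0) := by
  cases subsingleton_or_nontrivial E
  · simpa only [Subsingleton.elim _ (0 : E)] using tendsto_const_nhds
  have hradius : spectralRadius ℂ a < 1 := spectrum.spectralRadius_lt_of_forall_lt a ha
  obtain ⟨r, har, hr⟩ := ENNReal.lt_iff_exists_nnreal_btwn.mp hradius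
  have hpow : ∀ᶠ k in atTop, ‖a ^ k‖ ≤ (r : ℝ) ^ k := by
    have hgelfand := spectrum.pow_nnnorm_pow_one_div_tendsto_nhds_spectralRadius a
    filter_upwards [hgelfand.eventually_lt_const har, eventually_ne_atTop 0] with k hk hk0
    have := ENNReal.rpow_le_rpow hk.le k.cast_nonneg
    rw [← ENNReal.rpow_mul, one_div_mul_cancel (mod_cast hk0), ENNReal.rpow_one,
      ENNReal.rpow_natCast] at this
    exact_mod_cast this
  exact squeeze_zero_norm' hpow
    (tendsto_pow_atTop_nhds_zero_of_lt_one r.coe_nonneg (mod_cast hr))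

variable {n : ℕ} {S Z Q : Matrix (Fin n) (Fin n) ℂ}

open scoped Matrix.Norms.L2Operator in
theorem isOpen_setOf_isHurwitz (n : ℕ) :
    IsOpen {M : Matrix (Fin n) (Fin n) ℂ | IsHurwitz M} := by
  refine isOpen_iff_mem_nhds.mpr fun M hM => ?_
  have hopen : IsOpen {z : ℂ | z.re < 0} := isOpen_lt Complex.continuous_re continuous_const
  filter_upwards [upperHemicontinuous_spectrum ℂ _ M _ (hopen.mem_nhdsSet.mpr hM)] with N hN
  exact fun z hz => subset_of_mem_nhdsSet hN hz

/-- The Cayley transform `(1 + S) (1 - S)⁻¹`, which turns a Hurwitz matrix into one whose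
eigenvalues lie in the open unit disc and thereby the Lyapunov equation into a Stein equation. It
is meaningful when `1 - S` is invertible. -/
noncomputable def cayleyTransform (S : Matrix (Fin n) (Fin n) ℂ) : Matrix (Fin n) (Fin n) ℂ :=
  (1 + S) * (1 - S)⁻¹

theorem IsHurwitz.isUnit_smul_one_sub (hS : IsHurwitz S) {z : ℂ} (hz : 0 ≤ z.re) :
    IsUnit (z • 1 - S) := by
  rw [← Algebra.algebraMap_eq_smul_one]
  exact spectrum.notMem_iff.mp fun h => (hS z h).not_ge hz

theorem IsHurwitz.isUnit_one_sub (hS : IsHurwitz S) : IsUnit (1 - S) := by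
  simpa only [one_smul] using hS.isUnit_smul_one_sub (z := 1) (by simp)

theorem cayleyTransform_mul_one_sub (hS : IsUnit (1 - S)) :
    cayleyTransform S * (1 - S) = 1 + S := by
  rw [cayleyTransform,
    Matrix.nonsing_inv_mul_cancel_right _ _ ((Matrix.isUnit_iff_isUnit_det _).mp hS)]

theorem re_sub_one_div_add_one_nonneg {z : ℂ} (hz : 1 ≤ ‖z‖) : 0 ≤ ((z - 1) / (z + 1)).re := by
  have hsq : 1 ≤ z.re * z.re + z.im * z.im := by
    rw [← Complex.normSq_apply, Complex.normSq_eq_norm_sq]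
    exact one_le_pow₀ hz
  rw [Complex.div_re, ← add_div]
  refine div_nonneg ?_ (Complex.normSq_nonneg _)
  simp only [Complex.sub_re, Complex.add_re, Complex.sub_im, Complex.add_im, Complex.one_re,
    Complex.one_im]
  linarith

theorem IsHurwitz.norm_lt_one_of_mem_spectrum_cayleyTransform (hS : IsHurwitz S) {z : ℂ}
    (hz : z ∈ spectrum ℂ (cayleyTransform S)) : ‖z‖ < 1 := by
  by_contra! hnorm
  refine spectrum.notMem_iff.mpr (isUnit_of_mul_isUnit_left (y := 1 - S) ?_) hz
  have hmul : (algebraMap ℂ _ z - cayleyTransform S) * (1 - S) = (z - 1) • 1 - (z + 1) • S := by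
    rw [sub_mul, cayleyTransform_mul_one_sub hS.isUnit_one_sub, Algebra.algebraMap_eq_smul_one,
      smul_one_mul]
    module
  rw [hmul]
  by_cases hz1 : z + 1 = 0
  · rw [hz1, zero_smul, sub_zero, ← Algebra.algebraMap_eq_smul_one]
    refine (isUnit_iff_ne_zero.mpr fun h => ?_).map (algebraMap ℂ _)
    exact two_ne_zero (α := ℂ) (by linear_combination hz1 - h)
  · have hfactor : (z - 1) • 1 - (z + 1) • S = (z + 1) • (((z - 1) / (z + 1)) • 1 - S) := by
      rw [smul_sub, smul_smul, mul_div_cancel₀ _ hz1]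
    rw [hfactor]
    exact (hS.isUnit_smul_one_sub (re_sub_one_div_add_one_nonneg hnorm)).smul (Units.mk0 _ hz1)

open scoped Matrix.Norms.L2Operator in
theorem IsHurwitz.tendsto_cayleyTransform_pow (hS : IsHurwitz S) :
    Tendsto (fun k => cayleyTransform S ^ k) atTop (𝓝 0) :=
  tendsto_pow_atTop_nhds_zero_of_spectrum
    fun _ => hS.norm_lt_one_of_mem_spectrum_cayleyTransform

theorem IsHurwitz.tendsto_sub_stein_pow (hS : IsHurwitz S) (Z : Matrix (Fin n) (Fin n) ℂ) :
    Tendsto (fun k => Z - (cayleyTransform S ^ k)ᴴ * Z * cayleyTransform S ^ k) atTop (𝓝 Z) := by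
  have hT := hS.tendsto_cayleyTransform_pow
  have hTH : Tendsto (fun k => (cayleyTransform S ^ k)ᴴ) atTop (𝓝 0) := by
    simpa only [Matrix.star_eq_conjTranspose, Matrix.conjTranspose_zero] using hT.star
  simpa only [zero_mul, sub_zero] using
    tendsto_const_nhds.sub ((hTH.mul tendsto_const_nhds).mul hT)

theorem sub_conjTranspose_cayleyTransform_mul_mul (hS : IsUnit (1 - S))
    (Z : Matrix (Fin n) (Fin n) ℂ) :
    Z - (cayleyTransform S)ᴴ * Z * cayleyTransform S =
      ((1 - S)⁻¹)ᴴ * (-2 • (Sᴴ * Z + Z * S)) * (1 - S)⁻¹ := by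
  have hdet := (Matrix.isUnit_iff_isUnit_det _).mp hS
  have hZ : Z = ((1 - S)⁻¹)ᴴ * ((1 - S)ᴴ * Z * (1 - S)) * (1 - S)⁻¹ := by
    rw [← mul_assoc, ← mul_assoc, Matrix.mul_nonsing_inv_cancel_right _ _ hdet,
      ← Matrix.conjTranspose_mul, Matrix.mul_nonsing_inv _ hdet, Matrix.conjTranspose_one, one_mul]
  calc Z - (cayleyTransform S)ᴴ * Z * cayleyTransform S
      = ((1 - S)⁻¹)ᴴ * ((1 - S)ᴴ * Z * (1 - S) - (1 + S)ᴴ * Z * (1 + S)) * (1 - S)⁻¹ := by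
        rw [mul_sub, sub_mul, ← hZ, cayleyTransform, Matrix.conjTranspose_mul]
        simp only [mul_assoc]
    _ = _ := by
        congr 2
        simp only [Matrix.conjTranspose_sub, Matrix.conjTranspose_add, Matrix.conjTranspose_one]
        noncomm_ring

theorem IsHurwitz.eq_zero_of_lyapunov (hS : IsHurwitz S) (hZ : Sᴴ * Z + Z * S = 0) : Z = 0 := by
  set T := cayleyTransform S
  have hstein : Tᴴ * Z * T = Z := by
    have h := sub_conjTranspose_cayleyTransform_mul_mul hS.isUnit_one_sub Z
    rw [hZ, smul_zero, mul_zero, zero_mul, sub_eq_zero] at h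
    exact h.symm
  have hpow (k : ℕ) : Z - (T ^ k)ᴴ * Z * T ^ k = 0 := by
    induction k with
    | zero => simp
    | succ k ih =>
      calc Z - (T ^ (k + 1))ᴴ * Z * T ^ (k + 1)
          = Z - (T ^ k)ᴴ * (Tᴴ * Z * T) * T ^ k := by
            rw [pow_succ', Matrix.conjTranspose_mul]
            simp only [mul_assoc]
        _ = 0 := by rw [hstein, ih]
  have hlim := hS.tendsto_sub_stein_pow Z
  simp only [T, hpow] at hlim
  exact tendsto_nhds_unique hlim tendsto_const_nhds

open scoped Matrix.Norms.L2Operator MatrixOrder in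
theorem IsHurwitz.posSemidef_of_lyapunov (hS : IsHurwitz S)
    (hZ : (-(Sᴴ * Z + Z * S)).PosSemidef) : Z.PosSemidef := by
  set T := cayleyTransform S
  have hstein : (Z - Tᴴ * Z * T).PosSemidef := by
    rw [sub_conjTranspose_cayleyTransform_mul_mul hS.isUnit_one_sub]
    refine Matrix.PosSemidef.conjTranspose_mul_mul_same ?_ _
    convert hZ.add hZ using 1
    module
  have hpow (k : ℕ) : (Z - (T ^ k)ᴴ * Z * T ^ k).PosSemidef := by
    induction k with
    | zero => simpa using Matrix.PosSemidef.zero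
    | succ k ih =>
      convert ih.add (hstein.conjTranspose_mul_mul_same (T ^ k)) using 1
      rw [pow_succ', Matrix.conjTranspose_mul]
      noncomm_ring
  have hlim := hS.tendsto_sub_stein_pow Z
  exact Matrix.nonneg_iff_posSemidef.mp
    (ge_of_tendsto' hlim fun k => Matrix.nonneg_iff_posSemidef.mpr (hpow k))

theorem IsHurwitz.exists_lyapunov (hS : IsHurwitz S) (Q : Matrix (Fin n) (Fin n) ℂ) :
    ∃ Z, Sᴴ * Z + Z * S = Q := by
  let L : Matrix (Fin n) (Fin n) ℂ →ₗ[ℂ] Matrix (Fin n) (Fin n) ℂ :=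
    LinearMap.mulLeft ℂ Sᴴ + LinearMap.mulRight ℂ S
  have hL : Function.Injective L :=
    (injective_iff_map_eq_zero L).mpr fun _ hZ => hS.eq_zero_of_lyapunov hZ
  exact LinearMap.surjective_of_injective hL Q

theorem IsHurwitz.exists_posSemidef_lyapunov (hS : IsHurwitz S) (hQ : Q.PosSemidef) :
    ∃ Z : Matrix (Fin n) (Fin n) ℂ, Z.PosSemidef ∧ Sᴴ * Z + Z * S = -Q := by
  obtain ⟨Z, hZ⟩ := hS.exists_lyapunov (-Q)
  exact ⟨Z, hS.posSemidef_of_lyapunov (by rwa [hZ, neg_neg]), hZ⟩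

end Lyapunov

section Splitting

variable {K V : Type*} [Field K] [AddCommGroup V] [Module K V]

/-- The sum of the generalized eigenspaces of `f` for the eigenvalues in `s`. -/
noncomputable def spectralSubspace (f : Module.End K V) (s : Set K) : Submodule K V :=
  ⨆ z ∈ s, f.maxGenEigenspace z

theorem maxGenEigenspace_le_spectralSubspace (f : Module.End K V) {s : Set K} {z : K}
    (hz : z ∈ s) : f.maxGenEigenspace z ≤ spectralSubspace f s :=
  le_iSup₂_of_le z hz le_rfl

theorem mapsTo_spectralSubspace (f : Module.End K V) (s : Set K) :
    ∀ x ∈ spectralSubspace f s, f x ∈ spectralSubspace f s := by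
  change spectralSubspace f s ≤ (spectralSubspace f s).comap f
  exact iSup₂_le fun z hz x hx => maxGenEigenspace_le_spectralSubspace f hz
    (Module.End.mapsTo_maxGenEigenspace_of_comm (Commute.refl f) z hx)

theorem mem_of_hasEigenvalue_restrict_spectralSubspace {f : Module.End K V} {s : Set K} {z : K}
    (hz : Module.End.HasEigenvalue (f.restrict (mapsTo_spectralSubspace f s)) z) : z ∈ s := by
  by_contra hzs
  obtain ⟨x, hx⟩ := hz.exists_hasEigenvector
  have hmem : (x : V) ∈ f.maxGenEigenspace z :=
    (f.genEigenspace z).monotone (le_top : (1 : ℕ∞) ≤ ⊤)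
      (Module.End.mem_eigenspace_iff.mpr (congrArg Subtype.val hx.apply_eq_smul))
  have hdisj := f.independent_maxGenEigenspace.disjoint_biSup hzs
  exact hx.2 (Subtype.ext (Submodule.disjoint_def.mp hdisj _ hmem x.2))

theorem isCompl_spectralSubspace [IsAlgClosed K] [FiniteDimensional K V] (f : Module.End K V)
    {s t : Set K} (hst : Disjoint s t) (hf : ∀ z, f.HasEigenvalue z → z ∈ s ∪ t) :
    IsCompl (spectralSubspace f s) (spectralSubspace f t) := by
  refine ⟨f.independent_maxGenEigenspace.disjoint_biSup_biSup hst, ?_⟩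
  rw [codisjoint_iff, eq_top_iff, ← f.iSup_maxGenEigenspace_eq_top]
  refine iSup_le fun z => ?_
  by_cases hz : f.maxGenEigenspace z = ⊥
  · exact hz ▸ bot_le
  rcases hf z (Module.End.HasUnifEigenvalue.lt (k := ⊤) one_pos hz) with hs | ht
  · exact le_sup_of_le_left (maxGenEigenspace_le_spectralSubspace f hs)
  · exact le_sup_of_le_right (maxGenEigenspace_le_spectralSubspace f ht)

variable {ι : Type*} [Fintype ι]

theorem exists_mul_eq_mul_of_invariant (R : Matrix ι ι K) {X : Submodule K (ι → K)}
    (hX : ∀ x ∈ X, R.mulVecLin x ∈ X) :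
    ∃ (W : Matrix ι (Fin (Module.finrank K X)) K)
      (S : Matrix (Fin (Module.finrank K X)) (Fin (Module.finrank K X)) K),
      R * W = W * S ∧ Function.Injective W.mulVec ∧ (∀ x, W *ᵥ x ∈ X) ∧
        spectrum K S = spectrum K (R.mulVecLin.restrict hX) := by
  classical
  let b := Module.finBasis K X
  let e := Pi.basisFun K ι
  have hW (x) : LinearMap.toMatrix b e X.subtype *ᵥ x = b.equivFun.symm x := by
    ext i
    simp [Matrix.mulVec, dotProduct, Module.Basis.equivFun_symm_apply, mul_comm,
      LinearMap.toMatrix_apply, e]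
  refine ⟨LinearMap.toMatrix b e X.subtype, LinearMap.toMatrix b b (R.mulVecLin.restrict hX),
    ?_, fun x y hxy => ?_, fun x => ?_, LinearMap.spectrum_toMatrix _ b⟩
  · rw [← LinearMap.toMatrix_comp, LinearMap.subtype_comp_restrict, LinearMap.domRestrict,
      LinearMap.toMatrix_comp b e e, LinearMap.toMatrix_eq_toMatrix', ← Matrix.toLin'_apply',
      LinearMap.toMatrix'_toLin']
  · simpa only [hW, SetLike.coe_eq_coe, EmbeddingLike.apply_eq_iff_eq] using hxy
  · exact hW x ▸ Subtype.prop _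

theorem exists_mul_eq_mul_of_spectrum_subset_union [DecidableEq ι] [IsAlgClosed K]
    (R : Matrix ι ι K) {s t : Set K} (hst : Disjoint s t) (hR : spectrum K R ⊆ s ∪ t) :
    ∃ (k l : ℕ) (W₁ : Matrix ι (Fin k) K) (W₂ : Matrix ι (Fin l) K)
      (S₁ : Matrix (Fin k) (Fin k) K) (S₂ : Matrix (Fin l) (Fin l) K),
      k + l = Fintype.card ι ∧ R * W₁ = W₁ * S₁ ∧ R * W₂ = W₂ * S₂ ∧
        spectrum K S₁ ⊆ s ∧ spectrum K S₂ ⊆ t ∧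
        Function.Injective (Matrix.fromCols W₁ W₂).mulVec := by
  set f : Module.End K (ι → K) := R.mulVecLin
  have hcompl : IsCompl (spectralSubspace f s) (spectralSubspace f t) := by
    refine isCompl_spectralSubspace f hst fun z hz => hR ?_
    rw [← Matrix.spectrum_toLin']
    exact hz.mem_spectrum
  obtain ⟨W₁, S₁, hRW₁, hinj₁, hmem₁, hspec₁⟩ :=
    exists_mul_eq_mul_of_invariant R (mapsTo_spectralSubspace f s)
  obtain ⟨W₂, S₂, hRW₂, hinj₂, hmem₂, hspec₂⟩ :=
    exists_mul_eq_mul_of_invariant R (mapsTo_spectralSubspace f t)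
  refine ⟨_, _, W₁, W₂, S₁, S₂, ?_, hRW₁, hRW₂, fun z hz => ?_, fun z hz => ?_, ?_⟩
  · rw [Submodule.finrank_add_eq_of_isCompl hcompl, Module.finrank_pi]
  · exact mem_of_hasEigenvalue_restrict_spectralSubspace
      (Module.End.hasEigenvalue_iff_mem_spectrum.mpr (hspec₁ ▸ hz))
  · exact mem_of_hasEigenvalue_restrict_spectralSubspace
      (Module.End.hasEigenvalue_iff_mem_spectrum.mpr (hspec₂ ▸ hz))
  · refine (injective_iff_map_eq_zero (Matrix.fromCols W₁ W₂).mulVecLin).mpr fun x hx => ?_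
    rw [Matrix.mulVecLin_apply, Matrix.fromCols_mulVec] at hx
    have hzero₁ : W₁ *ᵥ (x ∘ Sum.inl) = 0 :=
      Submodule.disjoint_def.mp hcompl.disjoint _ (hmem₁ _)
        (eq_neg_of_add_eq_zero_left hx ▸ Submodule.neg_mem _ (hmem₂ _))
    rw [hzero₁, zero_add] at hx
    have hinl := hinj₁ (hzero₁.trans (Matrix.mulVec_zero _).symm)
    have hinr := hinj₂ (hx.trans (Matrix.mulVec_zero _).symm)
    exact funext (Sum.rec (congrFun hinl) (congrFun hinr))

end Splitting

section Symplectic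

open Matrix

variable {α ι κ : Type*} [DecidableEq ι]

theorem conjTranspose_J [CommRing α] [StarRing α] : (J ι α)ᴴ = -J ι α := by
  simp [J, fromBlocks_conjTranspose, fromBlocks_neg]

variable [Fintype ι] [Fintype κ]

/-- `R` is infinitesimally symplectic for the sesquilinear form `(x, y) ↦ x* J y`. Up to the sign
convention for `J`, this is what makes the matrix of a Riccati inequality Hamiltonian. -/
def IsHamiltonian [CommRing α] [StarRing α] (R : Matrix (ι ⊕ ι) (ι ⊕ ι) α) : Prop :=
  Rᴴ * J ι α + J ι α * R = 0

theorem isHamiltonian_fromBlocks [CommRing α] [StarRing α] {A D G : Matrix ι ι α}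
    (hD : D.IsHermitian) (hG : G.IsHermitian) : IsHamiltonian (fromBlocks A (-D) (-G) (-Aᴴ)) := by
  simp [IsHamiltonian, J, fromBlocks_conjTranspose, fromBlocks_multiply, hD.eq, hG.eq,
    fromBlocks_add, fromBlocks_zero]

theorem IsHamiltonian.neg [CommRing α] [StarRing α] {R : Matrix (ι ⊕ ι) (ι ⊕ ι) α}
    (hR : IsHamiltonian R) : IsHamiltonian (-R) := by
  rw [IsHamiltonian] at hR ⊢
  rw [conjTranspose_neg, neg_mul, mul_neg, ← neg_add, hR, neg_zero]

theorem IsHamiltonian.conjTranspose_mul_add_mul_eq_zero {κ' : Type*} [Fintype κ'] [CommRing α]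
    [StarRing α] {R : Matrix (ι ⊕ ι) (ι ⊕ ι) α} (hR : IsHamiltonian R)
    {W : Matrix (ι ⊕ ι) κ α} {W' : Matrix (ι ⊕ ι) κ' α} {S : Matrix κ κ α} {S' : Matrix κ' κ' α}
    (h : R * W = W * S) (h' : R * W' = W' * S') :
    Sᴴ * (Wᴴ * J ι α * W') + Wᴴ * J ι α * W' * S' = 0 := by
  calc Sᴴ * (Wᴴ * J ι α * W') + Wᴴ * J ι α * W' * S'
      = (W * S)ᴴ * J ι α * W' + Wᴴ * J ι α * (W' * S') := by
        simp only [conjTranspose_mul, Matrix.mul_assoc]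
    _ = Wᴴ * (Rᴴ * J ι α + J ι α * R) * W' := by
        rw [← h, ← h', conjTranspose_mul]
        simp only [Matrix.mul_assoc, Matrix.mul_add, Matrix.add_mul]
    _ = 0 := by rw [IsHamiltonian] at hR; rw [hR, Matrix.mul_zero, Matrix.zero_mul]

theorem IsHamiltonian.isotropic_of_isHurwitz {R : Matrix (ι ⊕ ι) (ι ⊕ ι) ℂ} (hR : IsHamiltonian R)
    {k : ℕ} {W : Matrix (ι ⊕ ι) (Fin k) ℂ} {S : Matrix (Fin k) (Fin k) ℂ} (h : R * W = W * S)
    (hS : IsHurwitz S) : Wᴴ * J ι ℂ * W = 0 :=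
  hS.eq_zero_of_lyapunov (hR.conjTranspose_mul_add_mul_eq_zero h h)

theorem card_le_card_of_isotropic [Field α] [PartialOrder α] [StarRing α] [StarOrderedRing α]
    {W : Matrix (ι ⊕ ι) κ α} (hW : Function.Injective W.mulVec) (hiso : Wᴴ * J ι α * W = 0) :
    Fintype.card κ ≤ Fintype.card ι := by
  have hrank : W.rank = Fintype.card κ := by
    rw [rank, LinearMap.finrank_range_of_inj hW, Module.finrank_fintype_fun_eq_card]
  have hrankJ : (Wᴴ * J ι α).rank = Fintype.card κ := by
    rw [rank_mul_eq_left_of_isUnit_det _ _ (isUnit_det_J _ _), rank_conjTranspose, hrank]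
  have hle := rank_add_rank_le_card_of_mul_eq_zero hiso
  rw [hrank, hrankJ, Fintype.card_sum] at hle
  lia

theorem injective_mulVec_of_fromCols {ρ κ' : Type*} [Fintype κ'] [Semiring α]
    {W₁ : Matrix ρ κ α} {W₂ : Matrix ρ κ' α} (h : Function.Injective (fromCols W₁ W₂).mulVec) :
    Function.Injective W₁.mulVec ∧ Function.Injective W₂.mulVec := by
  constructor <;> intro x y hxy
  · have heq := @h (Sum.elim x 0) (Sum.elim y 0) (by simp [fromCols_mulVec, hxy])
    exact funext fun i => congrFun heq (Sum.inl i)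
  · have heq := @h (Sum.elim 0 x) (Sum.elim 0 y) (by simp [fromCols_mulVec, hxy])
    exact funext fun i => congrFun heq (Sum.inr i)

theorem isUnit_of_isUnit_fromBlocks_zero [Field α] {N N' : Matrix ι ι α}
    (h : IsUnit (fromBlocks 0 N N' 0)) : IsUnit N := by
  rw [← mulVec_injective_iff_isUnit] at h ⊢
  intro x y hxy
  have heq := @h (Sum.elim 0 x) (Sum.elim 0 y) (by simp [fromBlocks_mulVec, hxy])
  exact funext fun i => congrFun heq (Sum.inr i)

theorem conjTranspose_fromCols_mul_J_mul_fromCols [CommRing α] [StarRing α]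
    {W₁ W₂ : Matrix (ι ⊕ ι) ι α} (h₁ : W₁ᴴ * J ι α * W₁ = 0) (h₂ : W₂ᴴ * J ι α * W₂ = 0) :
    (fromCols W₁ W₂)ᴴ * J ι α * fromCols W₁ W₂ =
      fromBlocks 0 (W₁ᴴ * J ι α * W₂) (-(W₁ᴴ * J ι α * W₂)ᴴ) 0 := by
  have hskew : W₂ᴴ * J ι α * W₁ = -(W₁ᴴ * J ι α * W₂)ᴴ := by
    simp [conjTranspose_mul, conjTranspose_J, Matrix.mul_assoc]
  rw [conjTranspose_fromCols_eq_fromRows_conjTranspose, fromRows_mul, fromRows_mul_fromCols,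
    h₁, h₂, hskew]

theorem exists_symplectic_basis_of_lagrangian_pair {n : ℕ}
    {R : Matrix (Fin n ⊕ Fin n) (Fin n ⊕ Fin n) ℂ} (hR : IsHamiltonian R)
    {W₁ W₂ : Matrix (Fin n ⊕ Fin n) (Fin n) ℂ} {S₁ S₂ : Matrix (Fin n) (Fin n) ℂ}
    (hRW₁ : R * W₁ = W₁ * S₁) (hRW₂ : R * W₂ = W₂ * S₂)
    (hinj : Function.Injective (fromCols W₁ W₂).mulVec)
    (hiso₁ : W₁ᴴ * J (Fin n) ℂ * W₁ = 0) (hiso₂ : W₂ᴴ * J (Fin n) ℂ * W₂ = 0) :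
    ∃ T : Matrix (Fin n ⊕ Fin n) (Fin n ⊕ Fin n) ℂ,
      Tᴴ * J (Fin n) ℂ * T = J (Fin n) ℂ ∧ R * T = T * fromBlocks S₁ 0 0 (-S₁ᴴ) := by
  set N := W₁ᴴ * J (Fin n) ℂ * W₂ with hN
  have hdet : IsUnit N.det := by
    rw [← isUnit_iff_isUnit_det]
    refine isUnit_of_isUnit_fromBlocks_zero (N' := -Nᴴ) ?_
    rw [← conjTranspose_fromCols_mul_J_mul_fromCols hiso₁ hiso₂]
    have hE := mulVec_injective_iff_isUnit.mp hinj
    exact (hE.star.mul ((isUnit_iff_isUnit_det _).mpr (isUnit_det_J _ _))).mul hE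
  have hcross : W₁ᴴ * J (Fin n) ℂ * -(W₂ * N⁻¹) = -1 := by
    rw [Matrix.mul_neg, ← Matrix.mul_assoc, ← hN, mul_nonsing_inv _ hdet]
  have hiso₂' : (-(W₂ * N⁻¹))ᴴ * J (Fin n) ℂ * -(W₂ * N⁻¹) = 0 := by
    calc _ = N⁻¹ᴴ * (W₂ᴴ * J (Fin n) ℂ * W₂) * N⁻¹ := by
          simp [conjTranspose_mul, Matrix.mul_assoc]
      _ = 0 := by rw [hiso₂, Matrix.mul_zero, Matrix.zero_mul]
  have hadjoint : S₂ * N⁻¹ = N⁻¹ * -S₁ᴴ := by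
    have h := eq_neg_of_add_eq_zero_right (hR.conjTranspose_mul_add_mul_eq_zero hRW₁ hRW₂)
    rw [← hN] at h
    calc S₂ * N⁻¹ = N⁻¹ * (N * S₂) * N⁻¹ := by rw [nonsing_inv_mul_cancel_left _ _ hdet]
      _ = N⁻¹ * -S₁ᴴ := by
        rw [h, ← Matrix.neg_mul, ← Matrix.mul_assoc, mul_nonsing_inv_cancel_right _ _ hdet]
  refine ⟨fromCols W₁ (-(W₂ * N⁻¹)), ?_, ?_⟩
  · rw [conjTranspose_fromCols_mul_J_mul_fromCols hiso₁ hiso₂', hcross]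
    simp [J]
  · rw [mul_fromCols, fromCols_mul_fromBlocks, hRW₁, Matrix.mul_neg, ← Matrix.mul_assoc, hRW₂,
      Matrix.mul_assoc, hadjoint]
    simp [Matrix.mul_assoc]

theorem IsHamiltonian.exists_symplectic_normal_form {n : ℕ}
    {R : Matrix (Fin n ⊕ Fin n) (Fin n ⊕ Fin n) ℂ} (hR : IsHamiltonian R)
    (hspec : ∀ z ∈ spectrum ℂ R, z.re ≠ 0) :
    ∃ (T : Matrix (Fin n ⊕ Fin n) (Fin n ⊕ Fin n) ℂ) (S : Matrix (Fin n) (Fin n) ℂ),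
      IsHurwitz S ∧ Tᴴ * J (Fin n) ℂ * T = J (Fin n) ℂ ∧
        R * T = T * fromBlocks S 0 0 (-Sᴴ) := by
  obtain ⟨k, l, W₁, W₂, S₁, S₂, hkl, hRW₁, hRW₂, hS₁, hS₂, hinj⟩ :=
    exists_mul_eq_mul_of_spectrum_subset_union R (s := {z | z.re < 0}) (t := {z | 0 < z.re})
      (Set.disjoint_left.mpr fun _ hneg hpos => lt_asymm (α := ℝ) hneg hpos)
      fun z hz => lt_or_gt_of_ne (hspec z hz)
  have hS₂' : IsHurwitz (-S₂) := fun z hz => by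
    rw [← spectrum.neg_eq] at hz
    exact neg_pos.mp (hS₂ hz)
  have hiso₁ := hR.isotropic_of_isHurwitz hRW₁ hS₁
  have hiso₂ := hR.neg.isotropic_of_isHurwitz (by rw [Matrix.neg_mul, hRW₂, Matrix.mul_neg]) hS₂'
  obtain ⟨hinj₁, hinj₂⟩ := injective_mulVec_of_fromCols hinj
  have hkn : k ≤ n := by simpa using card_le_card_of_isotropic hinj₁ hiso₁
  have hln : l ≤ n := by simpa using card_le_card_of_isotropic hinj₂ hiso₂
  rw [Fintype.card_sum, Fintype.card_fin] at hkl
  obtain rfl : k = n := by lia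
  obtain rfl : l = k := by lia
  obtain ⟨T, hT, hRT⟩ :=
    exists_symplectic_basis_of_lagrangian_pair hR hRW₁ hRW₂ hinj hiso₁ hiso₂
  exact ⟨T, S₁, hS₁, hT, hRT⟩

end Symplectic

section Graph

open Matrix

variable {α ι : Type*} [CommRing α] [Fintype ι] [DecidableEq ι]

/-- The block column `[1; H]`, whose columns span the graph of `H`. -/
def graph (H : Matrix ι ι α) : Matrix (ι ⊕ ι) ι α :=
  fromRows 1 H

theorem graph_mul (H X : Matrix ι ι α) : graph H * X = fromRows X (H * X) := by
  rw [graph, fromRows_mul, Matrix.one_mul]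

theorem fromBlocks_mul_graph (U U' V V' H : Matrix ι ι α) :
    fromBlocks U U' V V' * graph H = fromRows (U + U' * H) (V + V' * H) := by
  rw [graph, fromBlocks_mul_fromRows, Matrix.mul_one, Matrix.mul_one]

theorem fromBlocks_mul_graph_eq_graph_mul {U U' V V' Y : Matrix ι ι α}
    (hX : IsUnit (U + U' * Y)) :
    fromBlocks U U' V V' * graph Y =
      graph ((V + V' * Y) * (U + U' * Y)⁻¹) * (U + U' * Y) := by
  rw [fromBlocks_mul_graph, graph_mul,
    nonsing_inv_mul_cancel_right _ _ ((isUnit_iff_isUnit_det _).mp hX)]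

variable [StarRing α]

/-- The left-hand side `H A + A* H + G - H D H` of the Riccati inequality. -/
def riccati (A D G H : Matrix ι ι α) : Matrix ι ι α :=
  H * A + Aᴴ * H + G - H * D * H

theorem conjTranspose_graph_mul_J_mul_fromRows (H P Q : Matrix ι ι α) :
    (graph H)ᴴ * (J ι α * fromRows P Q) = Hᴴ * P - Q := by
  rw [graph, J, fromBlocks_mul_fromRows, conjTranspose_fromRows_eq_fromCols_conjTranspose,
    fromCols_mul_fromRows, conjTranspose_one]
  noncomm_ring

theorem conjTranspose_graph_mul_J_mul_graph (H : Matrix ι ι α) :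
    (graph H)ᴴ * (J ι α * graph H) = Hᴴ - H := by
  nth_rewrite 2 [graph]
  rw [conjTranspose_graph_mul_J_mul_fromRows, Matrix.mul_one]

theorem conjTranspose_graph_mul_J_mul_hamiltonian_mul_graph {A D G H : Matrix ι ι α}
    (hH : H.IsHermitian) :
    (graph H)ᴴ * (J ι α * (fromBlocks A (-D) (-G) (-Aᴴ) * graph H)) = riccati A D G H := by
  rw [fromBlocks_mul_graph, conjTranspose_graph_mul_J_mul_fromRows, hH.eq, riccati]
  noncomm_ring

section Transport

variable {T : Matrix (ι ⊕ ι) (ι ⊕ ι) α} {A D G S X Y H : Matrix ι ι α}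

theorem isHermitian_of_mul_graph_eq_graph_mul (hT : Tᴴ * J ι α * T = J ι α) (hX : IsUnit X)
    (hgraph : T * graph Y = graph H * X) (hY : Y.IsHermitian) : H.IsHermitian := by
  have hzero : Xᴴ * (Hᴴ - H) * X = 0 := by
    calc Xᴴ * (Hᴴ - H) * X = (graph H * X)ᴴ * (J ι α * (graph H * X)) := by
          rw [← conjTranspose_graph_mul_J_mul_graph, conjTranspose_mul]
          simp only [Matrix.mul_assoc]
      _ = (graph Y)ᴴ * (Tᴴ * J ι α * T * graph Y) := by
          rw [← hgraph, conjTranspose_mul]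
          simp only [Matrix.mul_assoc]
      _ = 0 := by rw [hT, conjTranspose_graph_mul_J_mul_graph, hY.eq, sub_self]
  exact sub_eq_zero.mp (hX.star.mul_right_eq_zero.mp (hX.mul_left_eq_zero.mp hzero))

theorem conjTranspose_mul_riccati_mul (hT : Tᴴ * J ι α * T = J ι α)
    (hRT : fromBlocks A (-D) (-G) (-Aᴴ) * T = T * fromBlocks S 0 0 (-Sᴴ))
    (hgraph : T * graph Y = graph H * X) (hY : Y.IsHermitian) (hH : H.IsHermitian) :
    Xᴴ * riccati A D G H * X = Sᴴ * Y + Y * S := by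
  calc Xᴴ * riccati A D G H * X
      = (graph H * X)ᴴ * (J ι α * (fromBlocks A (-D) (-G) (-Aᴴ) * (graph H * X))) := by
        rw [← conjTranspose_graph_mul_J_mul_hamiltonian_mul_graph hH, conjTranspose_mul]
        simp only [Matrix.mul_assoc]
    _ = (graph Y)ᴴ * (Tᴴ * J ι α * T * (fromBlocks S 0 0 (-Sᴴ) * graph Y)) := by
        rw [← hgraph, conjTranspose_mul, ← Matrix.mul_assoc (fromBlocks A _ _ _), hRT]
        simp only [Matrix.mul_assoc]
    _ = Sᴴ * Y + Y * S := by
        rw [hT, fromBlocks_mul_graph, conjTranspose_graph_mul_J_mul_fromRows, hY.eq]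
        noncomm_ring

theorem closedLoop_mul {U U' V V' : Matrix ι ι α}
    (hRT : fromBlocks A (-D) (-G) (-Aᴴ) * fromBlocks U U' V V' =
      fromBlocks U U' V V' * fromBlocks S 0 0 (-Sᴴ))
    (hgraph : fromBlocks U U' V V' * graph Y = graph H * (U + U' * Y)) :
    (A - D * H) * (U + U' * Y) = (U + U' * Y) * S - U' * (Sᴴ * Y + Y * S) := by
  have hcols : fromBlocks A (-D) (-G) (-Aᴴ) * (graph H * (U + U' * Y)) =
      fromBlocks U U' V V' * (fromBlocks S 0 0 (-Sᴴ) * graph Y) := by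
    rw [← hgraph, ← Matrix.mul_assoc, hRT, Matrix.mul_assoc]
  rw [graph_mul, fromBlocks_mul_graph, fromBlocks_mul_fromRows, fromBlocks_mul_fromRows,
    fromRows_ext_iff] at hcols
  calc (A - D * H) * (U + U' * Y) = A * (U + U' * Y) + -D * (H * (U + U' * Y)) := by noncomm_ring
    _ = U * (S + 0 * Y) + U' * (0 + -Sᴴ * Y) := hcols.1
    _ = (U + U' * Y) * S - U' * (Sᴴ * Y + Y * S) := by noncomm_ring

end Transport

end Graph

section Perturbation

open Matrix

theorem exists_projection_onto_ker {K ι κ : Type*} [Field K] [Fintype ι]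
    (U : Matrix κ ι K) :
    ∃ P : Matrix ι ι K, U * P = 0 ∧ ∀ x, U *ᵥ x = 0 → P *ᵥ x = x := by
  classical
  obtain ⟨g, hg⟩ := LinearMap.exists_extend (LinearMap.id : LinearMap.ker U.mulVecLin →ₗ[K] _)
  have hP (x) : LinearMap.toMatrix' (Submodule.subtype _ ∘ₗ g) *ᵥ x = g x :=
    LinearMap.toMatrix'_mulVec _ x
  refine ⟨LinearMap.toMatrix' (Submodule.subtype _ ∘ₗ g), mulVec_injective (funext fun x => ?_),
    fun x hx => ?_⟩
  · rw [← mulVec_mulVec, hP, zero_mulVec]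
    exact (g x).2
  · rw [hP]
    exact congrArg Subtype.val (LinearMap.congr_fun hg ⟨x, hx⟩)

variable {𝕜 ι : Type*} [Fintype ι] [DecidableEq ι] {U N P : Matrix ι ι 𝕜}

theorem isUnit_add_mul_of_projection [Field 𝕜] (hUP : U * P = 0)
    (hP : ∀ x, U *ᵥ x = 0 → P *ᵥ x = x)
    (htrans : ∀ a b, U *ᵥ a = 0 → N *ᵥ a = U *ᵥ b → a = 0) : IsUnit (U + N * P) := by
  rw [← mulVec_injective_iff_isUnit]
  refine (injective_iff_map_eq_zero (U + N * P).mulVecLin).mpr fun x hx => ?_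
  rw [mulVecLin_apply, add_mulVec, ← mulVec_mulVec] at hx
  have hPx : P *ᵥ x = 0 := by
    refine htrans _ (-x) (by rw [mulVec_mulVec, hUP, zero_mulVec]) ?_
    rw [mulVec_neg, eq_neg_of_add_eq_zero_right hx]
  rw [hPx, mulVec_zero, add_zero] at hx
  rw [← hP x hx, hPx]

theorem inv_mul_eq_one_sub_of_projection [CommRing 𝕜] (hUP : U * P = 0) (hPP : P * P = P)
    (hunit : IsUnit (U + N * P)) : (U + N * P)⁻¹ * U = 1 - P := by
  have hU : (U + N * P) * (1 - P) = U := by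
    rw [mul_sub, mul_one, add_mul, mul_assoc, hUP, hPP]
    abel
  nth_rewrite 2 [← hU]
  rw [nonsing_inv_mul_cancel_left _ _ ((isUnit_iff_isUnit_det _).mp hunit)]

theorem exists_tendsto_smul_inv [NontriviallyNormedField 𝕜] {N : 𝕜 → Matrix ι ι 𝕜}
    (hN : ContinuousAt N 0)
    (htrans : ∀ a b, U *ᵥ a = 0 → N 0 *ᵥ a = U *ᵥ b → a = 0) :
    (∀ᶠ t in 𝓝[≠] 0, IsUnit (U + t • N t)) ∧
      ∃ L, L * U = 0 ∧ Tendsto (fun t => t • (U + t • N t)⁻¹) (𝓝[≠] 0) (𝓝 L) := by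
  obtain ⟨P, hUP, hP⟩ := exists_projection_onto_ker U
  have hPP : P * P = P := mulVec_injective (funext fun x => by
    rw [← mulVec_mulVec, hP _ (by rw [mulVec_mulVec, hUP, zero_mulVec])])
  -- On `ker U` the sum is of order `t`; dividing by `t` there leaves `M`, invertible at `t = 0`.
  let Q : 𝕜 → Matrix ι ι 𝕜 := fun t => P + t • (1 - P)
  let M : 𝕜 → Matrix ι ι 𝕜 := fun t => U + N t * Q t
  have hQ0 : Q 0 = P := by simp [Q]
  have hM0 : M 0 = U + N 0 * P := by simp [M, hQ0]
  have hQ : ContinuousAt Q 0 := by fun_prop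
  have hM : ContinuousAt M 0 := continuousAt_const.add (hN.mul hQ)
  have hunit : IsUnit (M 0) := hM0 ▸ isUnit_add_mul_of_projection hUP hP htrans
  have hfactor (t) : (U + t • N t) * Q t = t • M t := by
    simp only [Q, M, add_mul, mul_add, mul_sub, mul_smul_comm, smul_mul_assoc, mul_one, hUP]
    module
  have hMunit : ∀ᶠ t in 𝓝[≠] 0, IsUnit (M t) := by
    simp only [isUnit_iff_isUnit_det, isUnit_iff_ne_zero] at hunit ⊢
    exact nhdsWithin_le_nhds
      ((continuous_id.matrix_det.continuousAt.comp hM).eventually_ne hunit)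
  have hXunit : ∀ᶠ t in 𝓝[≠] 0, IsUnit (U + t • N t) := by
    filter_upwards [hMunit, self_mem_nhdsWithin] with t ht ht0
    exact isUnit_of_mul_isUnit_left (hfactor t ▸ ht.smul (Units.mk0 t ht0))
  refine ⟨hXunit, P * (M 0)⁻¹, ?_, ?_⟩
  · rw [mul_assoc, hM0, inv_mul_eq_one_sub_of_projection hUP hPP (hM0 ▸ hunit), mul_sub, mul_one,
      hPP, sub_self]
  · have hinverse : ContinuousAt Ring.inverse (M 0).det := by
      rw [Ring.inverse_eq_inv']
      exact continuousAt_inv₀ ((isUnit_iff_isUnit_det _).mp hunit).ne_zero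
    have hlim : ContinuousAt (fun t => Q t * (M t)⁻¹) 0 :=
      hQ.mul ((continuousAt_matrix_inv _ hinverse).comp hM)
    rw [← hQ0]
    refine (hlim.tendsto.mono_left nhdsWithin_le_nhds).congr' ?_
    filter_upwards [hMunit, hXunit] with t hMt hXt
    rw [isUnit_iff_isUnit_det] at hMt hXt
    calc Q t * (M t)⁻¹ = (U + t • N t)⁻¹ * ((U + t • N t) * Q t) * (M t)⁻¹ := by
          rw [nonsing_inv_mul_cancel_left _ _ hXt]
      _ = t • (U + t • N t)⁻¹ := by
          rw [hfactor, mul_smul_comm, smul_mul_assoc, mul_nonsing_inv_cancel_right _ _ hMt]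

end Perturbation

section Transversality

open Matrix

theorem mul_J_mul_conjTranspose {α ι : Type*} [CommRing α] [StarRing α] [Fintype ι] [DecidableEq ι]
    {T : Matrix (ι ⊕ ι) (ι ⊕ ι) α} (hT : Tᴴ * J ι α * T = J ι α) : T * J ι α * Tᴴ = J ι α := by
  have hleft : -(J ι α * Tᴴ * J ι α) * T = 1 := by
    rw [neg_mul, mul_assoc, mul_assoc, ← mul_assoc Tᴴ, hT, J_squared, neg_neg]
  have hright : T * (J ι α * Tᴴ * J ι α) = -1 := by
    rw [← neg_eq_iff_eq_neg, ← mul_neg, mul_eq_one_comm.mp hleft]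
  calc T * J ι α * Tᴴ = -(T * (J ι α * Tᴴ * J ι α) * J ι α) := by
        simp only [mul_assoc, J_squared, mul_neg, mul_one, neg_neg]
    _ = J ι α := by rw [hright, neg_mul, one_mul, neg_neg]

section SymplecticBlocks

variable {α ι : Type*} [CommRing α] [StarRing α] [Fintype ι] [DecidableEq ι]
  {U U' V V' : Matrix ι ι α}

theorem symplectic_block_identities
    (hT : (fromBlocks U U' V V')ᴴ * J ι α * fromBlocks U U' V V' = J ι α) :
    Uᴴ * V = Vᴴ * U ∧ Uᴴ * V' - Vᴴ * U' = 1 ∧ V'ᴴ * U - U'ᴴ * V = 1 := by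
  simp only [fromBlocks_conjTranspose, J, fromBlocks_multiply, mul_zero, mul_one, zero_add,
    mul_neg, neg_mul, add_zero, ← sub_eq_add_neg, fromBlocks_inj] at hT
  obtain ⟨hUV, hUV', hVU', -⟩ := hT
  exact ⟨(sub_eq_zero.mp hUV).symm, by rw [← neg_sub, hUV', neg_neg], hVU'⟩

theorem symplectic_upper_blocks_comm
    (hT : (fromBlocks U U' V V')ᴴ * J ι α * fromBlocks U U' V V' = J ι α) :
    U * U'ᴴ = U' * Uᴴ := by
  have h := mul_J_mul_conjTranspose hT
  simp only [fromBlocks_conjTranspose, J, fromBlocks_multiply, mul_zero, mul_one, zero_add,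
    mul_neg, neg_mul, add_zero, ← sub_eq_add_neg, fromBlocks_inj] at h
  exact (sub_eq_zero.mp h.1).symm

end SymplecticBlocks

theorem injective_mulVec_of_rank_eq_card {K ρ κ : Type*} [Field K] [Fintype κ] {M : Matrix ρ κ K}
    (h : M.rank = Fintype.card κ) : Function.Injective M.mulVec := by
  rw [mulVec_injective_iff, linearIndependent_iff_card_eq_finrank_span, Set.finrank,
    ← rank_eq_finrank_span_cols, h]

section Controllability

variable {n m : ℕ} {A : Matrix (Fin n) (Fin n) ℂ} {B : Matrix (Fin n) (Fin m) ℂ}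

theorem controllabilityMatrix_neg (A : Matrix (Fin n) (Fin n) ℂ) (B : Matrix (Fin n) (Fin m) ℂ) :
    controllabilityMatrix (-A) B =
      controllabilityMatrix A B * diagonal fun p : Fin n × Fin m => (-1 : ℂ) ^ (p.1 : ℕ) := by
  ext i p
  rw [mul_diagonal, controllabilityMatrix, controllabilityMatrix, of_apply, of_apply]
  rcases Nat.even_or_odd (p.1 : ℕ) with h | h <;> simp [h.neg_pow]

theorem IsControllable.neg (h : IsControllable A B) : IsControllable (-A) B := by
  rw [IsControllable, controllabilityMatrix_neg, rank_mul_eq_left_of_isUnit_det _ _ ?_]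
  · exact h
  · rw [det_diagonal]
    exact isUnit_iff_ne_zero.mpr (Finset.prod_ne_zero_iff.mpr fun p _ => by simp)

theorem IsControllable.eq_bot_of_invariant (h : IsControllable A B)
    {K : Submodule ℂ (Fin n → ℂ)} (hB : ∀ x ∈ K, Bᴴ *ᵥ x = 0) (hA : ∀ x ∈ K, Aᴴ *ᵥ x ∈ K) :
    K = ⊥ := by
  have hpow (k : ℕ) {x} (hx : x ∈ K) : (Aᴴ ^ k) *ᵥ x ∈ K := by
    induction k with
    | zero => simpa using hx
    | succ k ih => simpa [pow_succ', ← mulVec_mulVec] using hA _ ih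
  have hinj : Function.Injective (controllabilityMatrix A B)ᴴ.mulVec :=
    injective_mulVec_of_rank_eq_card (by rw [rank_conjTranspose, h, Fintype.card_fin])
  refine (Submodule.eq_bot_iff K).mpr fun x hx => hinj ?_
  rw [mulVec_zero]
  ext ⟨k, q⟩
  have hblock : (A ^ (k : ℕ) * B)ᴴ *ᵥ x = 0 := by
    rw [conjTranspose_mul, conjTranspose_pow, ← mulVec_mulVec, hB _ (hpow k hx)]
  exact congrFun hblock q

end Controllability

theorem mulVec_eq_zero_of_mulVec_lyapunov_eq_zero {𝕜 ι κ : Type*} [RCLike 𝕜] [Fintype ι] [Fintype κ]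
    {S Z : Matrix ι ι 𝕜} {U : Matrix κ ι 𝕜} (hZ : Z.IsHermitian)
    (hlyap : Sᴴ * Z + Z * S = -(Uᴴ * U)) {c : ι → 𝕜} (hc : Z *ᵥ c = 0) :
    U *ᵥ c = 0 ∧ Z *ᵥ (S *ᵥ c) = 0 := by
  have hcZ : star c ᵥ* Z = 0 := by
    rw [← hZ.eq, ← star_mulVec, hc, star_zero]
  have hUc : U *ᵥ c = 0 := by
    have hnorm : -(star (U *ᵥ c) ⬝ᵥ U *ᵥ c) = 0 := by
      calc -(star (U *ᵥ c) ⬝ᵥ U *ᵥ c) = star c ⬝ᵥ -(Uᴴ * U) *ᵥ c := by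
            rw [neg_mulVec, dotProduct_neg, ← mulVec_mulVec, star_mulVec, ← dotProduct_mulVec]
        _ = star c ⬝ᵥ Sᴴ *ᵥ Z *ᵥ c + star c ᵥ* Z ⬝ᵥ S *ᵥ c := by
            rw [← hlyap, add_mulVec, dotProduct_add, mulVec_mulVec, ← dotProduct_mulVec,
              mulVec_mulVec]
        _ = 0 := by rw [hc, hcZ, mulVec_zero, dotProduct_zero, zero_dotProduct, add_zero]
    exact dotProduct_star_self_eq_zero.mp (neg_eq_zero.mp hnorm)
  refine ⟨hUc, ?_⟩
  have h := congrArg (· *ᵥ c) hlyap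
  simpa only [add_mulVec, neg_mulVec, ← mulVec_mulVec, hc, hUc, mulVec_zero, zero_add,
    neg_zero] using h

section HamiltonianBlocks

variable {n : ℕ} {A D G S U U' V V' Z : Matrix (Fin n) (Fin n) ℂ}

theorem eq_zero_of_lyapunov_mulVec_eq_zero (hD : D.IsHermitian) (hctrl : IsControllable A D)
    (hT : (fromBlocks U U' V V')ᴴ * J (Fin n) ℂ * fromBlocks U U' V V' = J (Fin n) ℂ)
    (hRT : fromBlocks A (-D) (-G) (-Aᴴ) * fromBlocks U U' V V' =
      fromBlocks U U' V V' * fromBlocks S 0 0 (-Sᴴ))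
    (hZ : Z.IsHermitian) (hlyap : Sᴴ * Z + Z * S = -(Uᴴ * U)) {c : Fin n → ℂ}
    (hc : Z *ᵥ c = 0) : c = 0 := by
  have hker {c} (hc : Z *ᵥ c = 0) := mulVec_eq_zero_of_mulVec_lyapunov_eq_zero hZ hlyap hc
  have hcols : A * U - D * V = U * S ∧ -(G * U) - Aᴴ * V = V * S := by
    simp only [fromBlocks_multiply, fromBlocks_inj] at hRT
    constructor
    · simpa [sub_eq_add_neg] using hRT.1
    · simpa [sub_eq_add_neg] using hRT.2.2.1
  have hK : (LinearMap.ker Z.mulVecLin).map V.mulVecLin = ⊥ := by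
    refine hctrl.eq_bot_of_invariant ?_ ?_ <;> rintro _ ⟨c, hc, rfl⟩ <;>
      obtain ⟨hUc, hZSc⟩ := hker hc
    · have h := congrArg (· *ᵥ c) hcols.1
      simpa [sub_mulVec, ← mulVec_mulVec, hUc, (hker hZSc).1, hD.eq] using h
    · refine ⟨-(S *ᵥ c), by simp [hZSc], ?_⟩
      have h := congrArg (· *ᵥ c) hcols.2
      simp only [sub_mulVec, neg_mulVec, ← mulVec_mulVec, hUc, mulVec_zero, neg_zero, zero_sub] at h
      simp [mulVec_neg, ← h]
  have hVc : V *ᵥ c = 0 := by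
    rw [← Submodule.mem_bot ℂ, ← hK]
    exact ⟨c, hc, rfl⟩
  rw [← one_mulVec c, ← (symplectic_block_identities hT).2.2, sub_mulVec, ← mulVec_mulVec,
    ← mulVec_mulVec, (hker hc).1, hVc, mulVec_zero, mulVec_zero, sub_zero]

theorem mulVec_eq_zero_of_mem_range_of_symplectic {𝕜 ι : Type*} [RCLike 𝕜] [Fintype ι]
    [DecidableEq ι] {U U' V V' Z : Matrix ι ι 𝕜}
    (hT : (fromBlocks U U' V V')ᴴ * J ι 𝕜 * fromBlocks U U' V V' = J ι 𝕜)
    (hZ : Z.PosSemidef) {a b : ι → 𝕜} (ha : U *ᵥ a = 0) (hab : (U' * Z) *ᵥ a = U *ᵥ b) :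
    Z *ᵥ a = 0 := by
  obtain ⟨hUV, hpair, -⟩ := symplectic_block_identities hT
  have hZa : Z *ᵥ a = Uᴴ *ᵥ (V' *ᵥ Z *ᵥ a - V *ᵥ b) := by
    calc Z *ᵥ a = (Uᴴ * V' - Vᴴ * U') *ᵥ Z *ᵥ a := by rw [hpair, one_mulVec]
      _ = Uᴴ *ᵥ V' *ᵥ Z *ᵥ a - Vᴴ *ᵥ (U' * Z) *ᵥ a := by
        simp only [sub_mulVec, ← mulVec_mulVec]
      _ = Uᴴ *ᵥ V' *ᵥ Z *ᵥ a - (Uᴴ * V) *ᵥ b := by 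
        rw [hab, hUV, mulVec_mulVec _ Vᴴ]
      _ = Uᴴ *ᵥ (V' *ᵥ Z *ᵥ a - V *ᵥ b) := by rw [← mulVec_mulVec, mulVec_sub]
  rw [← hZ.dotProduct_mulVec_zero_iff, hZa, dotProduct_mulVec, ← star_mulVec, ha, star_zero,
    zero_dotProduct]

end HamiltonianBlocks

end Transversality

section Stabilization

open Matrix

variable {n : ℕ}

theorem IsHurwitz.of_mul_eq_mul {M F X : Matrix (Fin n) (Fin n) ℂ} (hF : IsHurwitz F)
    (hX : IsUnit X) (h : M * X = X * F) : IsHurwitz M := by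
  obtain ⟨u, rfl⟩ := hX
  have hM : M = u.val * F * u⁻¹.val := by rw [← h, mul_assoc, Units.mul_inv, mul_one]
  rw [IsHurwitz, hM, spectrum.units_conjugate]
  exact hF

theorem IsHurwitz.eventually_isUnit_and_isHurwitz {S U U' Z₀ Z₁ : Matrix (Fin n) (Fin n) ℂ}
    (hS : IsHurwitz S) (hcomm : U * U'ᴴ = U' * Uᴴ)
    (htrans : ∀ a b, U *ᵥ a = 0 → (U' * Z₀) *ᵥ a = U *ᵥ b → a = 0) :
    ∀ᶠ t in 𝓝[≠] (0 : ℂ), IsUnit (U + U' * (t • (Z₀ + t • Z₁))) ∧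
      IsHurwitz (S + (U + U' * (t • (Z₀ + t • Z₁)))⁻¹ * (U' * (t • (Uᴴ * U + t • 1)))) := by
  have hN : Continuous fun t : ℂ => U' * (Z₀ + t • Z₁) := by fun_prop
  obtain ⟨hunit, L, hLU, hL⟩ := exists_tendsto_smul_inv (U := U) hN.continuousAt
    (by simpa using htrans)
  have hlim : Tendsto (fun t : ℂ => S + t • (U + t • (U' * (Z₀ + t • Z₁)))⁻¹ *
      (U' * (Uᴴ * U + t • 1))) (𝓝[≠] 0) (𝓝 S) := by
    have hV : Continuous fun t : ℂ => U' * (Uᴴ * U + t • (1 : Matrix (Fin n) (Fin n) ℂ)) := by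
      fun_prop
    have hresidue : L * (U' * (Uᴴ * U + (0 : ℂ) • 1)) = 0 := by
      rw [zero_smul, add_zero, ← mul_assoc U', ← hcomm, mul_assoc, ← mul_assoc, hLU, zero_mul]
    simpa only [hresidue, add_zero] using
      (hL.mul (hV.tendsto 0 |>.mono_left nhdsWithin_le_nhds)).const_add S
  filter_upwards [hunit, hlim.eventually ((isOpen_setOf_isHurwitz n).mem_nhds hS)] with t hX hHur
  simp only [mul_smul_comm, smul_mul_assoc] at hX hHur ⊢
  exact ⟨hX, hHur⟩

theorem exists_stabilizing_of_symplectic_normal_form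
    {A D G S U U' V V' Y : Matrix (Fin n) (Fin n) ℂ}
    (hT : (fromBlocks U U' V V')ᴴ * J (Fin n) ℂ * fromBlocks U U' V V' = J (Fin n) ℂ)
    (hRT : fromBlocks A (-D) (-G) (-Aᴴ) * fromBlocks U U' V V' =
      fromBlocks U U' V V' * fromBlocks S 0 0 (-Sᴴ))
    (hY : Y.IsHermitian) (hlyap : (-(Sᴴ * Y + Y * S)).PosDef) (hX : IsUnit (U + U' * Y))
    (hS : IsHurwitz (S + (U + U' * Y)⁻¹ * (U' * -(Sᴴ * Y + Y * S)))) :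
    ∃ H : Matrix (Fin n) (Fin n) ℂ,
      H.IsHermitian ∧ (-riccati A D G H).PosDef ∧ IsHurwitz (A - D * H) := by
  have hgraph := fromBlocks_mul_graph_eq_graph_mul (V := V) (V' := V') hX
  have hH := isHermitian_of_mul_graph_eq_graph_mul hT hX hgraph hY
  refine ⟨_, hH, ?_, hS.of_mul_eq_mul hX ?_⟩
  · rw [← hX.posDef_star_left_conjugate_iff, star_eq_conjTranspose, mul_neg, neg_mul,
      conjTranspose_mul_riccati_mul hT hRT hgraph hY hH]
    exact hlyap
  · rw [closedLoop_mul hRT hgraph, mul_add (U + U' * Y) S,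
      mul_nonsing_inv_cancel_left _ _ ((isUnit_iff_isUnit_det _).mp hX), mul_neg, sub_eq_add_neg]

theorem lyapunov_smul_add_smul {α ι : Type*} [CommRing α] [StarRing α] [Fintype ι]
    {S Z₀ Z₁ Q₀ Q₁ : Matrix ι ι α} (h₀ : Sᴴ * Z₀ + Z₀ * S = -Q₀) (h₁ : Sᴴ * Z₁ + Z₁ * S = -Q₁)
    (t : α) :
    Sᴴ * (t • (Z₀ + t • Z₁)) + t • (Z₀ + t • Z₁) * S = -(t • (Q₀ + t • Q₁)) := by
  calc _ = t • (Sᴴ * Z₀ + Z₀ * S) + (t * t) • (Sᴴ * Z₁ + Z₁ * S) := by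
        simp only [smul_add, mul_add, add_mul, mul_smul_comm, smul_mul_assoc]
        module
    _ = -(t • (Q₀ + t • Q₁)) := by
      rw [h₀, h₁]
      module

theorem tendsto_ofReal_nhdsGT_nhdsNE :
    Tendsto Complex.ofReal (𝓝[>] 0) (𝓝[≠] 0) := by
  refine tendsto_nhdsWithin_iff.mpr ⟨?_, ?_⟩
  · exact (Complex.continuous_ofReal.tendsto' 0 0 Complex.ofReal_zero).mono_left nhdsWithin_le_nhds
  · filter_upwards [self_mem_nhdsWithin] with t ht using Complex.ofReal_ne_zero.mpr ht.ne'

theorem exists_stabilizing {A D G : Matrix (Fin n) (Fin n) ℂ} (hD : D.IsHermitian)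
    (hG : G.IsHermitian) (hctrl : IsControllable A D)
    (hspec : ∀ z ∈ spectrum ℂ (fromBlocks A (-D) (-G) (-Aᴴ)), z.re ≠ 0) :
    ∃ H : Matrix (Fin n) (Fin n) ℂ,
      H.IsHermitian ∧ (-riccati A D G H).PosDef ∧ IsHurwitz (A - D * H) := by
  obtain ⟨T, S, hS, hT, hRT⟩ :=
    (isHamiltonian_fromBlocks (A := A) hD hG).exists_symplectic_normal_form hspec
  obtain ⟨U, U', V, V', rfl⟩ : ∃ U U' V V', T = fromBlocks U U' V V' :=
    ⟨_, _, _, _, (fromBlocks_toBlocks T).symm⟩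
  obtain ⟨Z₀, hZ₀, hlyap₀⟩ := hS.exists_posSemidef_lyapunov (posSemidef_conjTranspose_mul_self U)
  obtain ⟨Z₁, hZ₁, hlyap₁⟩ := hS.exists_posSemidef_lyapunov PosSemidef.one
  have htrans (a b) (ha : U *ᵥ a = 0) (hab : (U' * Z₀) *ᵥ a = U *ᵥ b) : a = 0 :=
    eq_zero_of_lyapunov_mulVec_eq_zero hD hctrl hT hRT hZ₀.isHermitian hlyap₀
      (mulVec_eq_zero_of_mem_range_of_symplectic hT hZ₀ ha hab)
  obtain ⟨t, ⟨hX, hHur⟩, ht⟩ := ((tendsto_ofReal_nhdsGT_nhdsNE.eventually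
    (hS.eventually_isUnit_and_isHurwitz (Z₁ := Z₁) (symplectic_upper_blocks_comm hT) htrans)).and
    self_mem_nhdsWithin).exists
  have htC : (0 : ℂ) < t := Complex.zero_lt_real.mpr ht
  have hlyap := neg_eq_iff_eq_neg.mpr (lyapunov_smul_add_smul hlyap₀ hlyap₁ (t : ℂ))
  refine exists_stabilizing_of_symplectic_normal_form hT hRT ?_ ?_ hX (by rwa [hlyap])
  · exact ((hZ₀.add (hZ₁.smul htC.le)).smul htC.le).isHermitian
  · rw [hlyap]
    exact (PosDef.posSemidef_add (posSemidef_conjTranspose_mul_self U)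
      (PosDef.one.smul htC)).smul htC

theorem spectrum_fromBlocks_neg_neg {𝕜 ι κ : Type*} [CommRing 𝕜] [Fintype ι] [DecidableEq ι]
    [Fintype κ] [DecidableEq κ] (A : Matrix ι ι 𝕜) (B : Matrix ι κ 𝕜) (C : Matrix κ ι 𝕜)
    (D : Matrix κ κ 𝕜) :
    spectrum 𝕜 (fromBlocks (-A) B C (-D)) = -spectrum 𝕜 (fromBlocks A B C D) := by
  let P : (Matrix (ι ⊕ κ) (ι ⊕ κ) 𝕜)ˣ :=
    ⟨fromBlocks 1 0 0 (-1), fromBlocks 1 0 0 (-1), by simp [fromBlocks_multiply],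
      by simp [fromBlocks_multiply]⟩
  have hP : fromBlocks (-A) B C (-D) = -(P.val * fromBlocks A B C D * P⁻¹.val) := by
    simp [P, fromBlocks_multiply, fromBlocks_neg]
  rw [hP, ← spectrum.neg_eq, spectrum.units_conjugate]

theorem exists_antistabilizing {A D G : Matrix (Fin n) (Fin n) ℂ} (hD : D.IsHermitian)
    (hG : G.IsHermitian) (hctrl : IsControllable A D)
    (hspec : ∀ z ∈ spectrum ℂ (fromBlocks A (-D) (-G) (-Aᴴ)), z.re ≠ 0) :
    ∃ H : Matrix (Fin n) (Fin n) ℂ,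
      H.IsHermitian ∧ (-riccati A D G H).PosDef ∧ IsHurwitz (-(A - D * H)) := by
  have hspec' : ∀ z ∈ spectrum ℂ (fromBlocks (-A) (-D) (-G) (-(-A)ᴴ)), z.re ≠ 0 := by
    rw [conjTranspose_neg, spectrum_fromBlocks_neg_neg]
    intro z hz
    exact neg_ne_zero.mp (hspec _ hz)
  obtain ⟨H, hH, hric, hHur⟩ := exists_stabilizing hD hG hctrl.neg hspec'
  refine ⟨-H, hH.neg, ?_, ?_⟩
  · convert hric using 2
    rw [riccati, riccati, conjTranspose_neg]
    noncomm_ring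
  · convert hHur using 1
    noncomm_ring

end Stabilization

theorem isSolution_iff {n m : ℕ} {A G H : Matrix (Fin n) (Fin n) ℂ} {B : Matrix (Fin n) (Fin m) ℂ}
    {Γ : Matrix (Fin m) (Fin m) ℂ} :
    IsSolution A B G Γ H ↔ H.IsHermitian ∧ (-riccati A (B * Γ⁻¹ * Bᴴ) G H).PosDef := by
  simp only [IsSolution, riccati, Matrix.mul_assoc]

end RiccatiInequality

theorem mainTheorem4 (n m : ℕ)
    (A : Matrix (Fin n) (Fin n) ℂ) (B : Matrix (Fin n) (Fin m) ℂ)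
    (G : Matrix (Fin n) (Fin n) ℂ) (Γ : Matrix (Fin m) (Fin m) ℂ)
    (hG : G.IsHermitian) (hΓ : Γ.IsHermitian) (hdet : Γ.det ≠ 0)
    (hctrl : RiccatiInequality.IsControllable A (B * Γ⁻¹ * Bᴴ))
    (hR : ∀ z ∈ spectrum ℂ (RiccatiInequality.hamiltonian A B G Γ), z.re ≠ 0) :
    (∃ Hminus : Matrix (Fin n) (Fin n) ℂ,
      RiccatiInequality.IsSolution A B G Γ Hminus ∧
      RiccatiInequality.IsHurwitz (A - B * Γ⁻¹ * Bᴴ * Hminus)) ∧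
    (∃ Hplus : Matrix (Fin n) (Fin n) ℂ,
      RiccatiInequality.IsSolution A B G Γ Hplus ∧
      RiccatiInequality.IsHurwitz (-(A - B * Γ⁻¹ * Bᴴ * Hplus))) := by
  have hD : (B * Γ⁻¹ * Bᴴ).IsHermitian := Matrix.isHermitian_mul_mul_conjTranspose B hΓ.inv
  simp only [RiccatiInequality.isSolution_iff, and_assoc]
  exact ⟨RiccatiInequality.exists_stabilizing hD hG hctrl hR,
    RiccatiInequality.exists_antistabilizing hD hG hctrl hR⟩
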